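/- All Banach spaces are real and non-zero. A Banach space $X$ has the Dunford–Pettis property if every weakly compact operator $T\colon X\to Y$ into a Banach space $Y$ is weak-to-norm sequentially continuous, that is, $x_n\to x$ weakly implies $\|Tx_n-Tx\|\to 0$. It is weakly almost square if for every $x\in X$ with $\|x\|=1$ there is a sequence $(y_n)$ in the closed unit ball of $X$ such that $\|x+y_n\|\to 1$, $\|x-y_n\|\to 1$, $\|y_n\|\to 1$ and $y_n\to 0$ weakly. A Banach space $Z$ has the local diameter two property if every slice $\{z\in Z:\|z\|\le 1,\ f(z)>\|f\|-\alpha\}$ of its closed unit ball, with $0\ne f\in Z^*$ and $\alpha>0$, has diameter two. For $N\ge 1$, the $N$-fold projective symmetric tensor product $\widehat{\otimes}_{\pi,s,N}X$ is the completion of the linear span of the tensors $x^N:=x\otimes\cdots\otimes x$ ($x\in X$) in the algebraic $N$-fold tensor product $\otimes^N X$ under the norm $$\|u\|=\inf\Big\{\sum_{i=1}^n|\lambda_i|\,\|x_i\|^N : u=\sum_{i=1}^n\lambda_i x_i^N,\ n\in\mathbb N,\ \lambda_i\in\mathbb R,\ x_i\in X\Big\}.$$ Proposition. Let $X$ be a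 Banach space with the Dunford–Pettis property. If $X$ is weakly almost square, then $\widehat{\otimes}_{\pi,s,N}X$ has the local diameter two property for every integer $N\ge 1$. -/

import Mathlib

open Filter Topology
open scoped TensorProduct

universe u

noncomputable section

/-- Weak convergence of the sequence `x` to `a`. -/
def WeaklyTendsto {X : Type u} [NormedAddCommGroup X] [NormedSpace ℝ X]
    (x : ℕ → X) (a : X) : Prop :=
  Tendsto (fun n => toWeakSpace ℝ X (x n)) atTop (𝓝 (toWeakSpace ℝ X a))

/-- An operator is weakly compact if the image of the closed unit ball is relatively compact
in the weak topology. -/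
def IsWeaklyCompactOperator {X Y : Type u} [NormedAddCommGroup X] [NormedSpace ℝ X]
    [NormedAddCommGroup Y] [NormedSpace ℝ Y] (T : X →L[ℝ] Y) : Prop :=
  IsCompact (closure (toWeakSpace ℝ Y '' (T '' Metric.closedBall (0 : X) 1)))

/-- The Dunford-Pettis property: every weakly compact operator into a Banach space is
weak-to-norm sequentially continuous. -/
def DunfordPettisProperty (X : Type u) [NormedAddCommGroup X] [NormedSpace ℝ X] : Prop :=
  ∀ (Y : Type u) [NormedAddCommGroup Y] [NormedSpace ℝ Y] [CompleteSpace Y] (T : X →L[ℝ] Y),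
    IsWeaklyCompactOperator T →
      ∀ (x : ℕ → X) (a : X), WeaklyTendsto x a → Tendsto (fun n => T (x n)) atTop (𝓝 (T a))

/-- Weakly almost square spaces (WASQ). -/
def WeaklyAlmostSquare (X : Type u) [NormedAddCommGroup X] [NormedSpace ℝ X] : Prop :=
  ∀ x : X, ‖x‖ = 1 → ∃ y : ℕ → X, (∀ n, ‖y n‖ ≤ 1) ∧
    Tendsto (fun n => ‖x + y n‖) atTop (𝓝 1) ∧
    Tendsto (fun n => ‖x - y n‖) atTop (𝓝 1) ∧
    Tendsto (fun n => ‖y n‖) atTop (𝓝 1) ∧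
    WeaklyTendsto y 0

/-- The slice of the closed unit ball given by the functional `f` and `α`
(recall that `‖f‖` is the supremum of `f` on the closed unit ball). -/
def unitBallSlice {Z : Type u} [NormedAddCommGroup Z] [NormedSpace ℝ Z]
    (f : StrongDual ℝ Z) (α : ℝ) : Set Z :=
  {z | ‖z‖ ≤ 1 ∧ ‖f‖ - α < f z}

/-- The local diameter two property (LD2P): every slice of the closed unit ball has
diameter two. -/
def LocalDiameterTwoProperty (Z : Type u) [NormedAddCommGroup Z] [NormedSpace ℝ Z] : Prop :=
  ∀ (f : StrongDual ℝ Z) (α : ℝ), f ≠ 0 → 0 < α → Metric.diam (unitBallSlice f α) = 2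

/-- The algebraic `N`-fold symmetric tensor product: the span of the tensors
`x ⊗ ⋯ ⊗ x` in the `N`-fold tensor product. -/
def symTensorSubmodule (N : ℕ) (X : Type u) [NormedAddCommGroup X] [NormedSpace ℝ X] :
    Submodule ℝ (⨂[ℝ] _ : Fin N, X) :=
  Submodule.span ℝ (Set.range fun x : X => PiTensorProduct.tprod ℝ fun _ : Fin N => x)

/-- The algebraic `N`-fold symmetric tensor product as a type of its own, so that it does not
inherit the norm that Mathlib puts on the full tensor product. -/
def SymTensor (N : ℕ) (X : Type u) [NormedAddCommGroup X] [NormedSpace ℝ X] : Type u :=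
  symTensorSubmodule N X

namespace SymTensor

variable {N : ℕ} {X : Type u} [NormedAddCommGroup X] [NormedSpace ℝ X]

instance : AddCommGroup (SymTensor N X) := inferInstanceAs (AddCommGroup (symTensorSubmodule N X))

instance : Module ℝ (SymTensor N X) := inferInstanceAs (Module ℝ (symTensorSubmodule N X))

/-- The elementary symmetric tensor `x ⊗ ⋯ ⊗ x`. -/
def pow (N : ℕ) (x : X) : SymTensor N X :=
  (⟨PiTensorProduct.tprod ℝ fun _ : Fin N => x, Submodule.subset_span ⟨x, rfl⟩⟩ :
    symTensorSubmodule N X)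

/-- The set of the numbers `∑ |λᵢ| ‖xᵢ‖ ^ N` over all representations `u = ∑ λᵢ xᵢ ^ N`. -/
def reprCosts (u : SymTensor N X) : Set ℝ :=
  {r | ∃ (n : ℕ) (c : Fin n → ℝ) (x : Fin n → X),
    u = ∑ i, c i • pow N (x i) ∧ r = ∑ i, |c i| * ‖x i‖ ^ N}

/-- The projective symmetric norm. -/
def projNorm (u : SymTensor N X) : ℝ := sInf (reprCosts u)

theorem nonneg_of_mem_reprCosts {u : SymTensor N X} {r : ℝ} (h : r ∈ reprCosts u) : 0 ≤ r := by
  obtain ⟨n, c, x, -, rfl⟩ := h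
  positivity

theorem bddBelow_reprCosts (u : SymTensor N X) : BddBelow (reprCosts u) :=
  ⟨0, fun _ h => nonneg_of_mem_reprCosts h⟩

theorem add_mem_reprCosts {u v : SymTensor N X} {r s : ℝ}
    (hr : r ∈ reprCosts u) (hs : s ∈ reprCosts v) : r + s ∈ reprCosts (u + v) := by
  obtain ⟨n, c, x, rfl, rfl⟩ := hr
  obtain ⟨m, d, y, rfl, rfl⟩ := hs
  exact ⟨n + m, Fin.append c d, Fin.append x y, by simp [Fin.sum_univ_add],
    by simp [Fin.sum_univ_add]⟩

theorem smul_mem_reprCosts {u : SymTensor N X} {r : ℝ} (a : ℝ)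
    (hr : r ∈ reprCosts u) : |a| * r ∈ reprCosts (a • u) := by
  obtain ⟨n, c, x, rfl, rfl⟩ := hr
  exact ⟨n, fun i => a * c i, x, by simp [Finset.smul_sum, mul_smul],
    by simp [Finset.mul_sum, abs_mul, mul_assoc]⟩

theorem zero_mem_reprCosts : (0 : ℝ) ∈ reprCosts (0 : SymTensor N X) :=
  ⟨0, 0, 0, by simp, by simp⟩

theorem reprCosts_nonempty (u : SymTensor N X) : (reprCosts u).Nonempty := by
  suffices H : ∀ (w : ⨂[ℝ] _ : Fin N, X) (hw : w ∈ symTensorSubmodule N X),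
      (reprCosts (N := N) (X := X) (⟨w, hw⟩ : symTensorSubmodule N X)).Nonempty from H u.1 u.2
  intro w hw
  induction hw using Submodule.span_induction with
  | mem w h =>
    obtain ⟨x, rfl⟩ := h
    exact ⟨_, 1, fun _ => 1, fun _ => x, by simp; rfl, rfl⟩
  | zero => exact ⟨0, zero_mem_reprCosts⟩
  | add v w hv hw ihv ihw =>
    obtain ⟨r, hr⟩ := ihv
    obtain ⟨s, hs⟩ := ihw
    exact ⟨r + s, add_mem_reprCosts hr hs⟩
  | smul a w hw ih =>
    obtain ⟨r, hr⟩ := ih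
    exact ⟨|a| * r, smul_mem_reprCosts a hr⟩

/-- The projective symmetric norm, as a seminorm. -/
def projSeminorm (N : ℕ) (X : Type u) [NormedAddCommGroup X] [NormedSpace ℝ X] :
    Seminorm ℝ (SymTensor N X) :=
  Seminorm.ofSMulLE projNorm
    (le_antisymm (csInf_le (bddBelow_reprCosts _) zero_mem_reprCosts)
      (Real.sInf_nonneg fun _ h => nonneg_of_mem_reprCosts h))
    (by
      intro u v
      refine le_of_forall_pos_le_add fun ε hε => ?_
      obtain ⟨r, hr, hr'⟩ := exists_lt_of_csInf_lt (reprCosts_nonempty u)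
        (lt_add_of_pos_right (sInf (reprCosts u)) (half_pos hε))
      obtain ⟨s, hs, hs'⟩ := exists_lt_of_csInf_lt (reprCosts_nonempty v)
        (lt_add_of_pos_right (sInf (reprCosts v)) (half_pos hε))
      have := csInf_le (bddBelow_reprCosts _) (add_mem_reprCosts hr hs)
      unfold projNorm
      linarith)
    (by
      intro a u
      unfold projNorm
      rw [Real.norm_eq_abs, ← smul_eq_mul, ← Real.sInf_smul_of_nonneg (abs_nonneg a)]
      refine csInf_le_csInf (bddBelow_reprCosts _) ((reprCosts_nonempty u).smul_set) ?_
      rintro _ ⟨r, hr, rfl⟩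
      exact smul_mem_reprCosts a hr)

instance : SeminormedAddCommGroup (SymTensor N X) :=
  (projSeminorm N X).toAddGroupSeminorm.toSeminormedAddCommGroup

instance : NormedSpace ℝ (SymTensor N X) where
  norm_smul_le a u := (map_smul_eq_mul (projSeminorm N X) a u).le

theorem norm_def (u : SymTensor N X) :
    ‖u‖ = sInf {r : ℝ | ∃ (n : ℕ) (c : Fin n → ℝ) (x : Fin n → X),
      u = ∑ i, c i • pow N (x i) ∧ r = ∑ i, |c i| * ‖x i‖ ^ N} := rfl

end SymTensor

/-- The `N`-fold projective symmetric tensor product: the completion of the algebraic symmetric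
tensor product under the projective symmetric norm (Mathlib's completion is the Hausdorff one, so
definiteness of the norm need not be proved beforehand). -/
abbrev ProjSymTensor (N : ℕ) (X : Type u) [NormedAddCommGroup X] [NormedSpace ℝ X] : Type u :=
  UniformSpace.Completion (SymTensor N X)

end

/-! A functional `f` on the tensor product is a continuous `N`-homogeneous polynomial on `X` whose
sup norm is `‖f‖`, so up to sign `x ^ N` lies in the slice for some unit vector `x`. Almost
squareness gives `yₙ → 0` weakly with `‖x ± yₙ‖ → 1` and `‖yₙ‖ → 1`. Under Dunford–Pettis,
polynomials are weakly sequentially continuous (`tendsto_multilinear`), so the normalised powers of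
`x ± yₙ` eventually enter the slice. Their distance is tested on `φₙ ⊗ ψ ⊗ ⋯ ⊗ ψ`, with `φₙ` norming
`yₙ` and `ψ` norming `x`. Since `φₙ x → 0` and `ψ yₙ → 0`, its values on the two powers tend to `1`
and `-1`, and the distance tends to two. -/

open scoped ZeroAtInfty

/-! ### Unit vectors of `c₀` and summability of functionals on it. -/

/-- The unit vectors of the space `C₀(ι, ℝ)` over a discrete space `ι`. -/
noncomputable def zeroAtInftySingle {ι : Type*} [TopologicalSpace ι] [DiscreteTopology ι]
    [DecidableEq ι] (i : ι) : C₀(ι, ℝ) where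
  toFun := (Pi.single i 1 : ι → ℝ)
  continuous_toFun := continuous_of_discreteTopology
  zero_at_infty' := by
    rw [cocompact_eq_cofinite]
    refine tendsto_const_nhds.congr' ?_
    filter_upwards [(Set.finite_singleton i).compl_mem_cofinite] with j hj
    exact (Pi.single_eq_of_ne (M := fun _ => ℝ) (by simpa using hj) _).symm

section ZeroAtInfty

variable {ι : Type*} [TopologicalSpace ι]

theorem ZeroAtInftyContinuousMap.norm_le_of_forall {f : C₀(ι, ℝ)} {C : ℝ} (hC : 0 ≤ C)
    (h : ∀ i, |f i| ≤ C) : ‖f‖ ≤ C := by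
  rw [← ZeroAtInftyContinuousMap.norm_toBCF_eq_norm]
  exact (BoundedContinuousFunction.norm_le hC).2 h

variable [DiscreteTopology ι] [DecidableEq ι]

theorem zeroAtInftySingle_apply (i j : ι) :
    zeroAtInftySingle i j = (Pi.single i 1 : ι → ℝ) j := rfl

theorem sum_smul_zeroAtInftySingle_apply (s : Finset ι) (c : ι → ℝ) (j : ι) :
    (∑ i ∈ s, c i • zeroAtInftySingle i : C₀(ι, ℝ)) j = if j ∈ s then c j else 0 := by
  have : (∑ i ∈ s, c i • zeroAtInftySingle i : C₀(ι, ℝ)) j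
      = ∑ i ∈ s, c i * (zeroAtInftySingle i : C₀(ι, ℝ)) j := by
    induction s using Finset.induction_on with
    | empty => simp
    | insert a s ha ih => simp [Finset.sum_insert ha, ih]
  rw [this]
  simp [zeroAtInftySingle_apply, Pi.single_apply]

theorem hasSum_smul_zeroAtInftySingle (a : C₀(ι, ℝ)) :
    HasSum (fun i => a i • zeroAtInftySingle i) a := by
  rw [HasSum, Metric.tendsto_nhds]
  intro ε hε
  have h := a.zero_at_infty'
  rw [cocompact_eq_cofinite, Metric.tendsto_nhds] at h
  have hfin := h (ε / 2) (half_pos hε)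
  rw [eventually_cofinite] at hfin
  refine (eventually_ge_atTop hfin.toFinset).mono fun s hs => ?_
  rw [dist_eq_norm]
  refine lt_of_le_of_lt (ZeroAtInftyContinuousMap.norm_le_of_forall (half_pos hε).le
    fun j => ?_) (half_lt_self hε)
  rw [ZeroAtInftyContinuousMap.sub_apply, sum_smul_zeroAtInftySingle_apply]
  split_ifs with hj
  · simpa using (half_pos hε).le
  · have : j ∉ hfin.toFinset := fun h' => hj (hs h')
    rw [Set.Finite.mem_toFinset] at this
    simp only [Set.mem_ofPred_eq, not_not, Real.dist_eq, sub_zero] at this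
    simpa using this.le

theorem summable_abs_apply_zeroAtInftySingle (g : StrongDual ℝ C₀(ι, ℝ)) :
    Summable fun i => |g (zeroAtInftySingle i)| := by
  refine summable_of_sum_le (c := ‖g‖) (fun i => abs_nonneg _) fun s => ?_
  -- Testing `g` on a finite vector of signs, of sup norm at most one, bounds each partial sum by
  -- `‖g‖`.
  set c : ι → ℝ := fun i => SignType.sign (g (zeroAtInftySingle i))
  have hc : ∀ i, |c i| ≤ 1 := fun i => by
    rcases lt_trichotomy (g (zeroAtInftySingle i)) 0 with h | h | h <;> simp [c, h]
  calc ∑ i ∈ s, |g (zeroAtInftySingle i)|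
      = g (∑ i ∈ s, c i • zeroAtInftySingle i) := by
        simp only [map_sum, map_smul, smul_eq_mul, c, sign_mul_self]
    _ ≤ ‖g‖ * ‖(∑ i ∈ s, c i • zeroAtInftySingle i : C₀(ι, ℝ))‖ :=
        (le_abs_self _).trans (g.le_opNorm _)
    _ ≤ ‖g‖ * 1 := by
        gcongr
        refine ZeroAtInftyContinuousMap.norm_le_of_forall zero_le_one fun j => ?_
        rw [sum_smul_zeroAtInftySingle_apply]
        split_ifs
        · exact hc j
        · simp
    _ = ‖g‖ := mul_one _

end ZeroAtInfty

/-! ### Weakly null sequences and the Dunford–Pettis property. -/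

section WeaklyNull

variable {X : Type u} [NormedAddCommGroup X] [NormedSpace ℝ X]

theorem weaklyTendsto_iff {x : ℕ → X} {a : X} :
    WeaklyTendsto x a ↔ ∀ g : StrongDual ℝ X, Tendsto (fun n => g (x n)) atTop (𝓝 (g a)) := by
  refine WeakBilin.tendsto_iff_forall_eval_tendsto (B := (topDualPairing ℝ X).flip) ?_
  intro p q h
  by_contra hne
  obtain ⟨g, hg⟩ := SeparatingDual.exists_separating_of_ne (R := ℝ) hne
  exact hg (LinearMap.congr_fun h g)

theorem exists_norm_le_of_weaklyTendsto {x : ℕ → X} {a : X}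
    (h : ∀ g : StrongDual ℝ X, Tendsto (fun n => g (x n)) atTop (𝓝 (g a))) :
    ∃ C, ∀ n, ‖x n‖ ≤ C := by
  obtain ⟨C, hC⟩ := banach_steinhaus
    (g := fun n => NormedSpace.inclusionInDoubleDual ℝ X (x n)) fun g => by
      obtain ⟨C, hC⟩ := (Metric.isBounded_range_of_tendsto _ (h g)).exists_norm_le
      exact ⟨C, fun n => hC _ ⟨n, rfl⟩⟩
  refine ⟨C, fun n => ?_⟩
  rw [← (NormedSpace.inclusionInDoubleDualLi ℝ).norm_map (x n)]
  exact hC n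

/-- The element of `c₀` given by the values of an element of the bidual on a weakly null sequence
of functionals. -/
noncomputable def weaklyNullEval (φ : ℕ → StrongDual ℝ X)
    (hφ : ∀ F : StrongDual ℝ (StrongDual ℝ X), Tendsto (fun n => F (φ n)) atTop (𝓝 0))
    (F : StrongDual ℝ (StrongDual ℝ X)) : C₀(ULift.{u} ℕ, ℝ) where
  toFun i := F (φ i.down)
  continuous_toFun := continuous_of_discreteTopology
  zero_at_infty' := by
    rw [cocompact_eq_cofinite]
    have h := hφ F
    rw [← Nat.cofinite_eq_atTop] at h
    exact h.comp ULift.down_injective.tendsto_cofinite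

theorem weaklyNullEval_apply (φ : ℕ → StrongDual ℝ X)
    (hφ : ∀ F : StrongDual ℝ (StrongDual ℝ X), Tendsto (fun n => F (φ n)) atTop (𝓝 0))
    (F : StrongDual ℝ (StrongDual ℝ X)) (i : ULift.{u} ℕ) :
    weaklyNullEval φ hφ F i = F (φ i.down) := rfl

/-- A functional `g` on `c₀` has summable coefficients `g eᵢ`, and `(φᵢ)` is bounded. Hence `g`
composed with this map is evaluation at `∑ g(eᵢ) φᵢ`, an element of the dual itself, and so is
weak-star continuous. -/
theorem continuous_weaklyNullEval (φ : ℕ → StrongDual ℝ X)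
    (hφ : ∀ F : StrongDual ℝ (StrongDual ℝ X), Tendsto (fun n => F (φ n)) atTop (𝓝 0)) :
    Continuous fun F : WeakDual ℝ (StrongDual ℝ X) =>
      toWeakSpace ℝ C₀(ULift.{u} ℕ, ℝ) (weaklyNullEval φ hφ (WeakDual.toStrongDual F)) := by
  obtain ⟨C, hC⟩ := exists_norm_le_of_weaklyTendsto (a := (0 : StrongDual ℝ X)) (x := φ)
    (by simpa using hφ)
  refine WeakBilin.continuous_of_continuous_eval _ fun g => ?_
  have hs : Summable fun i : ULift.{u} ℕ => g (zeroAtInftySingle i) • φ i.down := by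
    refine Summable.of_norm_bounded ((summable_abs_apply_zeroAtInftySingle g).mul_right C) ?_
    intro i
    rw [norm_smul, Real.norm_eq_abs]
    exact mul_le_mul_of_nonneg_left (hC _) (abs_nonneg _)
  refine (WeakDual.eval_continuous (∑' i : ULift.{u} ℕ, g (zeroAtInftySingle i) • φ i.down)).congr
    fun F => ?_
  have h1 := (WeakDual.toStrongDual F).hasSum hs.hasSum
  have h2 := g.hasSum (hasSum_smul_zeroAtInftySingle (weaklyNullEval φ hφ
    (WeakDual.toStrongDual F)))
  have h3 : (fun i : ULift.{u} ℕ => WeakDual.toStrongDual F (g (zeroAtInftySingle i) • φ i.down))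
      = fun i => g (weaklyNullEval φ hφ (WeakDual.toStrongDual F) i • zeroAtInftySingle i) := by
    ext i
    simp [weaklyNullEval_apply, mul_comm]
  rw [h3] at h1
  exact h1.unique h2

/-- The sequential form of the Dunford-Pettis property. -/
theorem DunfordPettisProperty.tendsto_apply (hDP : DunfordPettisProperty X)
    {φ : ℕ → StrongDual ℝ X}
    (hφ : ∀ F : StrongDual ℝ (StrongDual ℝ X), Tendsto (fun n => F (φ n)) atTop (𝓝 0))
    {x : ℕ → X} (hx : WeaklyTendsto x 0) : Tendsto (fun n => φ n (x n)) atTop (𝓝 0) := by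
  obtain ⟨C, hC⟩ := exists_norm_le_of_weaklyTendsto (a := (0 : StrongDual ℝ X)) (x := φ)
    (by simpa using hφ)
  have hC0 : 0 ≤ C := (norm_nonneg _).trans (hC 0)
  let J := NormedSpace.inclusionInDoubleDual ℝ X
  -- `T z = (φₙ z)ₙ`; the lift of `ℕ` puts `c₀` in the universe of `X`, as the definition of the
  -- property demands.
  let T : X →L[ℝ] C₀(ULift.{u} ℕ, ℝ) := LinearMap.mkContinuous
    { toFun := fun z => weaklyNullEval φ hφ (J z)
      map_add' := fun z w => by ext i; simp [weaklyNullEval_apply, J]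
      map_smul' := fun c z => by ext i; simp [weaklyNullEval_apply, J] } C fun z =>
    ZeroAtInftyContinuousMap.norm_le_of_forall (by positivity) fun i =>
      ((φ i.down).le_opNorm z).trans (mul_le_mul_of_nonneg_right (hC _) (norm_nonneg _))
  have hT : ∀ z n, T z ⟨n⟩ = φ n z := fun z n => rfl
  have hcomp : IsWeaklyCompactOperator T := by
    -- By Banach–Alaoglu the bidual ball has weakly compact image in `c₀`, and this image contains
    -- that of the unit ball of `X`.
    have hK := (WeakDual.isCompact_closedBall (𝕜 := ℝ) (0 : StrongDual ℝ (StrongDual ℝ X)) 1).image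
      (continuous_weaklyNullEval φ hφ)
    refine hK.closure_of_subset ?_
    rintro _ ⟨_, ⟨z, hz, rfl⟩, rfl⟩
    refine ⟨StrongDual.toWeakDual (J z), ?_, rfl⟩
    simp only [Set.mem_preimage, mem_closedBall_zero_iff] at hz ⊢
    exact (NormedSpace.double_dual_bound ℝ X z).trans hz
  have h := (hDP _ T hcomp x 0 hx).norm
  rw [map_zero, norm_zero] at h
  refine squeeze_zero_norm (fun n => ?_) h
  rw [← hT, ← ZeroAtInftyContinuousMap.norm_toBCF_eq_norm]
  exact (T (x n)).toBCF.norm_coe_le_norm ⟨n⟩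

/-- Continuous multilinear forms on a space with the Dunford-Pettis property are weakly
sequentially continuous. -/
theorem DunfordPettisProperty.tendsto_multilinear (hDP : DunfordPettisProperty X)
    {x : ℕ → X} {a : X} (hx : WeaklyTendsto x a) :
    ∀ (k : ℕ) (B : ContinuousMultilinearMap ℝ (fun _ : Fin k => X) ℝ),
      Tendsto (fun n => B fun _ => x n) atTop (𝓝 (B fun _ => a)) := by
  rw [weaklyTendsto_iff] at hx
  intro k
  induction k with
  | zero =>
    intro B
    have : ∀ n, (fun _ : Fin 0 => x n) = fun _ => a := fun n => Subsingleton.elim _ _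
    simp only [this, tendsto_const_nhds_iff]
  | succ k ih =>
    intro B
    let φ : ℕ → StrongDual ℝ X := fun n => B.curryRight fun _ => x n
    let ψ : StrongDual ℝ X := B.curryRight fun _ => a
    have hB : ∀ z w : X, B.curryRight (fun _ => z) w = B (Fin.snoc (fun _ => z) w) :=
      fun z w => rfl
    have hd : ∀ z : X, B (fun _ => z) = B.curryRight (fun _ => z) z := fun z => by
      rw [hB]
      congr 1
      ext i
      refine Fin.lastCases ?_ (fun j => ?_) i <;> simp
    -- `F` composed with the curried `B` is a `k`-linear form, so the induction hypothesis yields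
    -- weak convergence of `φ n` in the dual.
    have hφ : ∀ F : StrongDual ℝ (StrongDual ℝ X),
        Tendsto (fun n => F (φ n)) atTop (𝓝 (F ψ)) := fun F =>
      ih (F.compContinuousMultilinearMap B.curryRight)
    have h1 : Tendsto (fun n => (φ n - ψ) (x n - a)) atTop (𝓝 0) := by
      refine hDP.tendsto_apply (fun F => ?_) (weaklyTendsto_iff.2 fun g => ?_)
      · simpa using (hφ F).sub_const (F ψ)
      · simpa using (hx g).sub_const (g a)
    have h2 := hφ (NormedSpace.inclusionInDoubleDual ℝ X a)
    have h3 := hx ψ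
    have h := (h1.add h2).add (h3.sub_const (ψ a))
    -- The first summand is a weakly null pair, handled by Dunford–Pettis; in the others only one
    -- argument varies.
    have h4 : ∀ n, (φ n - ψ) (x n - a) + φ n a + (ψ (x n) - ψ a) = φ n (x n) := fun n => by
      simp only [sub_apply, map_sub]
      ring
    simp only [NormedSpace.dual_def, h4, sub_self, add_zero, zero_add] at h
    simpa only [hd] using h

end WeaklyNull

/-! ### Polarization and continuity of multilinear forms. -/

section Polarization

variable {N : ℕ} {X : Type u} [NormedAddCommGroup X] [NormedSpace ℝ X]

/-- The polarization formula, without assuming symmetry. -/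
theorem MultilinearMap.sum_perm_eq_sum_neg_one_pow
    (A : MultilinearMap ℝ (fun _ : Fin N => X) ℝ) (x : Fin N → X) :
    ∑ σ : Equiv.Perm (Fin N), A (fun i => x (σ i)) =
      ∑ T : Finset (Fin N), (-1) ^ T.card * A (fun _ => ∑ i ∈ Tᶜ, x i) := by
  have h1 : ∀ T : Finset (Fin N), (-1) ^ T.card * A (fun _ => ∑ i ∈ Tᶜ, x i) =
      ∑ r : Fin N → Fin N, if T ⊆ (Finset.univ.image r)ᶜ
        then (-1) ^ T.card * A (fun i => x (r i)) else 0 := by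
    intro T
    rw [A.map_sum_finset (fun _ j => x j) (fun _ => Tᶜ), Finset.mul_sum, ← Finset.sum_filter]
    refine Finset.sum_congr ?_ fun _ _ => rfl
    ext r
    simp only [Fintype.mem_piFinset, Finset.mem_filter, Finset.mem_univ, true_and,
      Finset.subset_iff, Finset.mem_compl, Finset.mem_image, not_exists]
    exact ⟨fun h j hj i hi => h i (hi ▸ hj), fun h i hi => h hi i rfl⟩
  -- Inclusion–exclusion: the signs over all `T` disjoint from the range of `r` cancel unless `r` is
  -- onto.
  have h2 : ∀ r : Fin N → Fin N, (∑ T : Finset (Fin N), if T ⊆ (Finset.univ.image r)ᶜ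
      then (-1) ^ T.card * A (fun i => x (r i)) else 0) =
      if Function.Bijective r then A (fun i => x (r i)) else 0 := by
    intro r
    have h3 := Finset.sum_powerset_neg_one_pow_card (x := (Finset.univ.image r)ᶜ)
    have h4 : (∑ m ∈ (Finset.univ.image r)ᶜ.powerset, (-1 : ℝ) ^ m.card) =
        if (Finset.univ.image r)ᶜ = ∅ then 1 else 0 := by
      exact_mod_cast congrArg (Int.cast : ℤ → ℝ) h3
    rw [← Finset.sum_filter, ← Finset.sum_mul, Finset.filter_subset_univ, h4, ite_mul, one_mul,
      zero_mul]
    congr 1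
    rw [Finset.compl_eq_empty_iff, ← Finite.surjective_iff_bijective, eq_iff_iff,
      ← Finset.coe_inj, Finset.coe_image, Finset.coe_univ, Set.image_univ, Set.range_eq_univ]
  rw [Finset.sum_congr rfl fun T _ => h1 T, Finset.sum_comm, Finset.sum_congr rfl fun r _ => h2 r,
    ← Finset.sum_filter]
  refine Finset.sum_bij (fun σ _ => (σ : Fin N → Fin N)) 
    (fun σ _ => Finset.mem_filter.2 ⟨Finset.mem_univ _, σ.bijective⟩)
    (fun _ _ _ _ h => DFunLike.coe_injective h) (fun r hr => ?_) fun _ _ => rfl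
  exact ⟨Equiv.ofBijective r (by simpa using hr), Finset.mem_univ _, rfl⟩

theorem MultilinearMap.abs_apply_le_of_unit (A : MultilinearMap ℝ (fun _ : Fin N => X) ℝ) {K : ℝ}
    (h : ∀ x : Fin N → X, (∀ i, ‖x i‖ ≤ 1) → |A x| ≤ K) (x : Fin N → X) :
    |A x| ≤ K * ∏ i, ‖x i‖ := by
  by_cases h0 : ∃ i, x i = 0
  · obtain ⟨i, hi⟩ := h0
    rw [A.map_coord_zero i hi, Finset.prod_eq_zero (Finset.mem_univ i) (by simp [hi])]
    simp
  · push Not at h0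
    have h1 := A.map_smul_univ (fun i => ‖x i‖) fun i => ‖x i‖⁻¹ • x i
    simp only [smul_smul, mul_inv_cancel₀ (norm_ne_zero_iff.2 (h0 _)), one_smul] at h1
    rw [h1, smul_eq_mul, abs_mul, mul_comm,
      abs_of_nonneg (Finset.prod_nonneg fun i _ => norm_nonneg _)]
    refine mul_le_mul_of_nonneg_right (h _ fun i => ?_)
      (Finset.prod_nonneg fun i _ => norm_nonneg _)
    rw [norm_smul, norm_inv, norm_norm, inv_mul_cancel₀ (norm_ne_zero_iff.2 (h0 i))]

/-- A function on `X` that is the restriction of a multilinear form to the diagonal and is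
bounded on the unit ball is the restriction of a continuous multilinear form to the diagonal. -/
theorem MultilinearMap.exists_continuous_diagonal_eq
    (A : MultilinearMap ℝ (fun _ : Fin N => X) ℝ) {C : ℝ} (hC : ∀ x, |A fun _ => x| ≤ C * ‖x‖ ^ N) :
    ∃ B : ContinuousMultilinearMap ℝ (fun _ : Fin N => X) ℝ, ∀ x, B (fun _ => x) = A fun _ => x := by
  have hC' : ∀ x, |A fun _ => x| ≤ |C| * ‖x‖ ^ N := fun x =>
    (hC x).trans (mul_le_mul_of_nonneg_right (le_abs_self C) (by positivity))
  -- `A` may be unbounded off the diagonal. Its symmetrization agrees with it on the diagonal and is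
  -- bounded by polarization.
  let S : MultilinearMap ℝ (fun _ : Fin N => X) ℝ :=
    (N.factorial : ℝ)⁻¹ • ∑ σ : Equiv.Perm (Fin N), A.domDomCongr σ
  have hS : ∀ x, S x = (N.factorial : ℝ)⁻¹ * ∑ σ : Equiv.Perm (Fin N), A (fun i => x (σ i)) := by
    intro x
    simp [S]
  have hb : ∀ x : Fin N → X, (∀ i, ‖x i‖ ≤ 1) →
      |S x| ≤ (N.factorial : ℝ)⁻¹ * ∑ _T : Finset (Fin N), |C| * N ^ N := by
    intro x hx
    rw [hS, A.sum_perm_eq_sum_neg_one_pow, abs_mul, abs_of_nonneg (by positivity)]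
    refine mul_le_mul_of_nonneg_left ((Finset.abs_sum_le_sum_abs _ _).trans
      (Finset.sum_le_sum fun T _ => ?_)) (by positivity)
    rw [abs_mul, abs_pow, abs_neg, abs_one, one_pow, one_mul]
    refine (hC' _).trans (mul_le_mul_of_nonneg_left (pow_le_pow_left₀ (norm_nonneg _) ?_ N)
      (abs_nonneg C))
    calc ‖∑ i ∈ Tᶜ, x i‖ ≤ ∑ i ∈ Tᶜ, (1 : ℝ) := norm_sum_le_of_le _ fun i _ => hx i
      _ ≤ N := by simpa using Finset.card_le_univ Tᶜ
  refine ⟨S.mkContinuous _ (S.abs_apply_le_of_unit hb), fun x => ?_⟩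
  rw [MultilinearMap.coe_mkContinuous, hS]
  simp [Fintype.card_perm, Nat.factorial_ne_zero]

end Polarization

/-! ### Functionals on the symmetric tensor product as polynomials. -/

namespace SymTensor

variable {N : ℕ} {X : Type u} [NormedAddCommGroup X] [NormedSpace ℝ X]

theorem norm_pow_le (x : X) : ‖pow N x‖ ≤ ‖x‖ ^ N := by
  rw [norm_def]
  exact csInf_le (bddBelow_reprCosts _) ⟨1, fun _ => 1, fun _ => x, by simp, by simp⟩

theorem pow_smul (c : ℝ) (x : X) : pow N (c • x) = c ^ N • pow N x := by
  refine Subtype.ext ?_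
  change PiTensorProduct.tprod ℝ (fun _ : Fin N => c • x) =
    c ^ N • PiTensorProduct.tprod ℝ fun _ : Fin N => x
  rw [MultilinearMap.map_smul_univ (PiTensorProduct.tprod ℝ) (fun _ => c)]
  simp

theorem abs_apply_le_of_pow (Q : SymTensor N X →ₗ[ℝ] ℝ) {C : ℝ} (hC : 0 ≤ C)
    (h : ∀ x, |Q (pow N x)| ≤ C * ‖x‖ ^ N) (u : SymTensor N X) : |Q u| ≤ C * ‖u‖ := by
  rw [norm_def, ← smul_eq_mul, ← Real.sInf_smul_of_nonneg hC]
  refine le_csInf (reprCosts_nonempty u).smul_set ?_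
  rintro _ ⟨r, ⟨n, c, x, rfl, rfl⟩, rfl⟩
  simp only [map_sum, smul_eq_mul, Finset.mul_sum]
  refine (Finset.abs_sum_le_sum_abs _ _).trans (Finset.sum_le_sum fun i _ => ?_)
  rw [map_smul, smul_eq_mul, abs_mul, mul_left_comm]
  exact mul_le_mul_of_nonneg_left (h _) (abs_nonneg _)

/-- The linear form on the symmetric tensor product induced by a product of linear forms. -/
noncomputable def prodForm (g : Fin N → StrongDual ℝ X) : SymTensor N X →ₗ[ℝ] ℝ :=
  (PiTensorProduct.lift ((MultilinearMap.mkPiAlgebra ℝ (Fin N) ℝ).compLinearMap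
    fun i => (g i : X →ₗ[ℝ] ℝ))).comp (symTensorSubmodule N X).subtype

theorem prodForm_pow (g : Fin N → StrongDual ℝ X) (x : X) :
    prodForm g (pow N x) = ∏ i, g i x := by
  change PiTensorProduct.lift _ (PiTensorProduct.tprod ℝ fun _ : Fin N => x) = _
  simp

/-- Products of functionals in the dual ball serve to bound the projective norm from below. -/
theorem abs_prodForm_le {g : Fin N → StrongDual ℝ X} (hg : ∀ i, ‖g i‖ ≤ 1) (u : SymTensor N X) :
    |prodForm g u| ≤ ‖u‖ := by
  refine (abs_apply_le_of_pow (prodForm g) zero_le_one (fun x => ?_) u).trans_eq (one_mul _)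
  rw [prodForm_pow, Finset.abs_prod, one_mul]
  calc ∏ i, |g i x| ≤ ∏ _i : Fin N, ‖x‖ :=
        Finset.prod_le_prod (fun _ _ => abs_nonneg _) fun i _ =>
          ((g i).le_of_opNorm_le (hg i) x).trans_eq (one_mul _)
    _ = ‖x‖ ^ N := by simp

theorem exists_continuous_diagonal_eq (f : StrongDual ℝ (ProjSymTensor N X)) :
    ∃ B : ContinuousMultilinearMap ℝ (fun _ : Fin N => X) ℝ,
      ∀ x, B (fun _ => x) = f (pow N x : SymTensor N X) := by
  let f' : symTensorSubmodule N X →ₗ[ℝ] ℝ :=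
    (f.comp (UniformSpace.Completion.toComplL (𝕜 := ℝ) (E := SymTensor N X))).toLinearMap
  -- `F` is a purely algebraic extension to the full tensor product; only its values on diagonal
  -- tensors are controlled.
  obtain ⟨F, hF⟩ := f'.exists_extend
  have hA : ∀ x : X, F.compMultilinearMap (PiTensorProduct.tprod ℝ) (fun _ : Fin N => x) =
      f (pow N x : SymTensor N X) := fun x =>
    LinearMap.congr_fun hF (pow N x : SymTensor N X)
  obtain ⟨B, hB⟩ := (F.compMultilinearMap
    (PiTensorProduct.tprod ℝ (s := fun _ : Fin N => X))).exists_continuous_diagonal_eq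
    (C := ‖f‖) fun x => by
      rw [hA]
      refine (f.le_opNorm _).trans (mul_le_mul_of_nonneg_left ?_ (norm_nonneg _))
      rw [UniformSpace.Completion.norm_coe]
      exact norm_pow_le x
  exact ⟨B, fun x => (hB x).trans (hA x)⟩

/-- The norm of a functional on the projective symmetric tensor product is the supremum norm of
the associated polynomial. -/
theorem exists_lt_abs_apply_pow (f : StrongDual ℝ (ProjSymTensor N X)) (hN : N ≠ 0) {M : ℝ}
    (hM : 0 ≤ M) (hMf : M < ‖f‖) : ∃ x : X, ‖x‖ = 1 ∧ M < |f (pow N x : SymTensor N X)| := by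
  have h : ∃ x : X, M * ‖x‖ ^ N < |f (pow N x : SymTensor N X)| := by
    by_contra! hcon
    refine hMf.not_ge (f.opNorm_le_bound hM fun z => ?_)
    induction z using UniformSpace.Completion.induction_on with
    | hp => exact isClosed_le (by fun_prop) (by fun_prop)
    | ih u =>
      rw [UniformSpace.Completion.norm_coe]
      exact abs_apply_le_of_pow
        (f.comp (UniformSpace.Completion.toComplL (𝕜 := ℝ) (E := SymTensor N X))).toLinearMap
        hM hcon u
  obtain ⟨x, hx⟩ := h
  have hle : |f (pow N x : SymTensor N X)| ≤ ‖f‖ * ‖x‖ ^ N := by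
    refine (f.le_opNorm _).trans (mul_le_mul_of_nonneg_left ?_ (norm_nonneg _))
    rw [UniformSpace.Completion.norm_coe]
    exact norm_pow_le x
  -- For `N ≠ 0` both sides of `hx` would vanish at `x = 0`.
  have hx0 : ‖x‖ ≠ 0 := fun h0 => by
    rw [h0, zero_pow hN, mul_zero] at hx hle
    exact hx.not_ge hle
  have hp : 0 < ‖x‖ ^ N := by positivity
  refine ⟨‖x‖⁻¹ • x, by rw [norm_smul, norm_inv, norm_norm, inv_mul_cancel₀ hx0], ?_⟩
  rw [pow_smul, UniformSpace.Completion.coe_smul, map_smul, smul_eq_mul, abs_mul, inv_pow, abs_inv,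
    abs_of_pos hp, inv_mul_eq_div, lt_div_iff₀ hp]
  exact hx

/-- The tensor power `x ^ N` divided by `‖x‖ ^ N`. -/
noncomputable def unitPow (N : ℕ) (x : X) : SymTensor N X := (‖x‖ ^ N)⁻¹ • pow N x

/-- The case `‖x‖ ^ N = 0` is included, since then the factor `(‖x‖ ^ N)⁻¹` is `0`. -/
theorem norm_unitPow_le (x : X) : ‖unitPow N x‖ ≤ 1 := by
  rw [unitPow, norm_smul, norm_inv, norm_pow, norm_norm]
  exact (mul_le_mul_of_nonneg_left (norm_pow_le x) (by positivity)).trans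
    (inv_mul_le_one)

end SymTensor

/-! ### Normalised powers of `x ± yₙ` and the diameter of slices. -/

open SymTensor in
theorem tendsto_apply_unitPow {X : Type u} [NormedAddCommGroup X] [NormedSpace ℝ X]
    (hDP : DunfordPettisProperty X) {N : ℕ} (f : StrongDual ℝ (ProjSymTensor N X))
    {x : ℕ → X} {a : X} (hx : WeaklyTendsto x a)
    (hn : Tendsto (fun n => ‖x n‖) atTop (𝓝 1)) :
    Tendsto (fun n => f (unitPow N (x n) : SymTensor N X)) atTop
      (𝓝 (f (pow N a : SymTensor N X))) := by
  obtain ⟨B, hB⟩ := exists_continuous_diagonal_eq f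
  have h1 := hDP.tendsto_multilinear hx N B
  simp only [hB] at h1
  have h2 := ((hn.pow N).inv₀ (by simp)).mul h1
  simpa [unitPow, UniformSpace.Completion.coe_smul] using h2

open SymTensor in
/-- If `‖x ± yₙ‖ → 1` and `‖yₙ‖ → 1`, then the tensor powers of `x + yₙ` and `x - yₙ` are
asymptotically at distance two. -/
theorem exists_tendsto_two_le_norm_unitPow_sub {X : Type u} [NormedAddCommGroup X]
    [NormedSpace ℝ X] [Nontrivial X] (m : ℕ) {x : X} (hx : ‖x‖ = 1) {y : ℕ → X}
    (hp : Tendsto (fun n => ‖x + y n‖) atTop (𝓝 1))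
    (hm : Tendsto (fun n => ‖x - y n‖) atTop (𝓝 1))
    (hy : Tendsto (fun n => ‖y n‖) atTop (𝓝 1)) (hw : WeaklyTendsto y 0) :
    ∃ d : ℕ → ℝ, Tendsto d atTop (𝓝 2) ∧
      ∀ n, d n ≤ ‖unitPow (m + 1) (x + y n) - unitPow (m + 1) (x - y n)‖ := by
  obtain ⟨ψ, hψ, hψx⟩ := exists_dual_vector' ℝ x
  -- Nontriviality of `X` provides a norm-one `φ n` even when `y n = 0`.
  choose φ hφ hφy using fun n => exists_dual_vector' ℝ (y n)
  simp only [hx, RCLike.ofReal_real_eq_id, id] at hψx hφy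
  have hφle : ∀ n z, φ n z ≤ ‖z‖ := fun n z =>
    (le_abs_self _).trans (((φ n).le_of_opNorm_le (hφ n).le z).trans_eq (one_mul _))
  -- Squeeze: `‖y n‖ + φ n x ≤ ‖x + y n‖` and `‖y n‖ - φ n x ≤ ‖x - y n‖`, where all the norms tend
  -- to `1`.
  have hφx : Tendsto (fun n => φ n x) atTop (𝓝 0) := by
    have h1 : Tendsto (fun n => ‖x + y n‖ - ‖y n‖) atTop (𝓝 0) := by simpa using hp.sub hy
    have h2 : Tendsto (fun n => ‖y n‖ - ‖x - y n‖) atTop (𝓝 0) := by simpa using hy.sub hm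
    refine tendsto_of_tendsto_of_tendsto_of_le_of_le h2 h1 (fun n => ?_) fun n => ?_
    · have := hφle n (y n - x)
      rw [map_sub, hφy, norm_sub_rev] at this
      dsimp only
      linarith
    · have := hφle n (x + y n)
      rw [map_add, hφy] at this
      dsimp only
      linarith
  have hψy : Tendsto (fun n => ψ (y n)) atTop (𝓝 0) := by
    simpa using weaklyTendsto_iff.1 hw ψ
  -- A single factor `φ n` detects the sign of `± y n`, while the `m` factors `ψ` tend to `1` on
  -- both vectors.
  let g : ℕ → Fin (m + 1) → StrongDual ℝ X := fun n => Fin.cons (φ n) fun _ => ψ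
  have hg : ∀ n i, ‖g n i‖ ≤ 1 := fun n i => by
    refine Fin.cases ?_ (fun j => ?_) i
    · exact (hφ n).le
    · exact hψ.le
  have hQ : ∀ n z, prodForm (g n) (unitPow (m + 1) z) =
      (‖z‖ ^ (m + 1))⁻¹ * (φ n z * ψ z ^ m) := fun n z => by
    rw [unitPow, map_smul, prodForm_pow, Fin.prod_univ_succ]
    simp [g]
  refine ⟨fun n => prodForm (g n) (unitPow (m + 1) (x + y n) - unitPow (m + 1) (x - y n)), ?_,
    fun n => (le_abs_self _).trans (abs_prodForm_le (hg n) _)⟩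
  simp only [map_sub, hQ, map_add, hφy, hψx]
  have h1 := ((hp.pow (m + 1)).inv₀ (by simp)).mul
    ((hφx.add hy).mul (((hψy.const_add 1)).pow m))
  have h2 := ((hm.pow (m + 1)).inv₀ (by simp)).mul
    ((hφx.sub hy).mul (((hψy.const_sub 1)).pow m))
  convert h1.sub h2 using 2
  norm_num

theorem proposition3p5 {X : Type u} [NormedAddCommGroup X] [NormedSpace ℝ X] [CompleteSpace X]
    [Nontrivial X] (hDP : DunfordPettisProperty X) (hW : WeaklyAlmostSquare X)
    (N : ℕ) (hN : 1 ≤ N) :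
    LocalDiameterTwoProperty (ProjSymTensor N X) := by
  intro f α hf hα
  have hle : ∀ z ∈ unitBallSlice f α, ∀ w ∈ unitBallSlice f α, dist z w ≤ 2 := by
    intro z hz w hw
    rw [dist_eq_norm]
    linarith [norm_sub_le z w, hz.1, hw.1]
  refine le_antisymm (Metric.diam_le_of_forall_dist_le zero_le_two hle) ?_
  -- The maximum with `0` covers `α > ‖f‖`, where the slice bound is negative.
  obtain ⟨x, hx, hfx⟩ := SymTensor.exists_lt_abs_apply_pow f (by omega) (le_max_right (‖f‖ - α) 0)
    (max_lt (sub_lt_self _ hα) (norm_pos_iff.2 hf))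
  -- `f` may be negative at `x ^ N`, and for even `N` the sign cannot be absorbed into `x`, so it
  -- multiplies the tensor.
  obtain ⟨s, hs, hsf⟩ : ∃ s : ℝ, |s| = 1 ∧ ‖f‖ - α < s * f (SymTensor.pow N x : SymTensor N X) := by
    have h := (le_max_left _ _).trans_lt hfx
    rcases abs_cases (f (SymTensor.pow N x : SymTensor N X)) with h' | h'
    · exact ⟨1, by simp, by linarith⟩
    · exact ⟨-1, by simp, by linarith⟩
  obtain ⟨y, -, hp, hm, hy, hw⟩ := hW x hx
  have hwp : WeaklyTendsto (fun n => x + y n) x := weaklyTendsto_iff.2 fun g => by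
    simpa using (weaklyTendsto_iff.1 hw g).const_add (g x)
  have hwm : WeaklyTendsto (fun n => x - y n) x := weaklyTendsto_iff.2 fun g => by
    simpa using (weaklyTendsto_iff.1 hw g).const_sub (g x)
  obtain ⟨m, rfl⟩ : ∃ m, N = m + 1 := ⟨N - 1, by omega⟩
  obtain ⟨d, hd, hd'⟩ := exists_tendsto_two_le_norm_unitPow_sub m hx hp hm hy hw
  have hmem : ∀ v : ℕ → X, WeaklyTendsto v x → Tendsto (fun n => ‖v n‖) atTop (𝓝 1) →
      ∀ᶠ n in atTop, ((s • SymTensor.unitPow (m + 1) (v n) : SymTensor (m + 1) X) :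
        ProjSymTensor (m + 1) X) ∈ unitBallSlice f α := by
    intro v hv hv'
    have h := (tendsto_apply_unitPow hDP f hv hv').const_mul s
    filter_upwards [h.eventually_const_lt hsf] with n hn
    refine ⟨?_, ?_⟩
    · rw [UniformSpace.Completion.norm_coe, norm_smul, Real.norm_eq_abs, hs, one_mul]
      exact SymTensor.norm_unitPow_le _
    · rwa [UniformSpace.Completion.coe_smul, map_smul, smul_eq_mul]
  refine le_of_tendsto hd ?_
  filter_upwards [hmem _ hwp hp, hmem _ hwm hm] with n h1 h2
  refine (hd' n).trans ?_
  have h3 := Metric.dist_le_diam_of_mem 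
    (Metric.isBounded_iff.2 ⟨2, fun z hz w hw => hle z hz w hw⟩) h1 h2
  rwa [UniformSpace.Completion.dist_eq, dist_eq_norm, ← smul_sub, norm_smul, Real.norm_eq_abs, hs,
    one_mul] at h3
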